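/- Let $Z\sim N(0,1)$, write $\Phi h=\mathbb{E}h(Z)$ and $\|g\|=\sup_{x\in\mathbb{R}}|g(x)|$, and let $C_b^\infty(\mathbb{R})$ be the set of smooth functions $\mathbb{R}\to\mathbb{R}$ that are bounded together with all their derivatives. For every $h\in C_b^\infty(\mathbb{R})$ and all constants $\delta,C>0$ there is a constant $K$, depending only on $\delta$, $C$ and $h$, such that the following holds for every $\alpha>0$. Let $(X_n)_{n\ge 1}$ be real random variables (possibly on different probability spaces) with moments of all orders such that, for each $n$, $\mathbb{E}|X_n|^k=o(k!)$ as $k\to\infty$. Put $\epsilon_{n,k}=\mathbb{E}X_n^k-\mathbb{E}Z^k$ for $k\ge 0$, and suppose that for all $n\ge1$ and $k\geq 1$ $$\|h^{(k)}\|\,|\epsilon_{n,k}|\leq \frac{C}{n^{\alpha}}k^{-\delta}(k-1)!\quad\text{and}\quad \|h^{(k+2)}\|\,|\epsilon_{n,k}|\leq \frac{C}{n^{\alpha}}k^{-\delta}(k-1)!.$$ Then, for every $n\ge 1$, the series below converges and $$|\mathbb{E}h(X_n)-\Phi h|\leq\|h'\|\,|\epsilon_{n,1}|+\sum_{k=1}^{\infty}\frac{\|h^{(k+1)}\|}{(k+1)!}\,\big|k\epsilon_{n,k-1}-\epsilon_{n,k+1}\big|\leq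 \frac{K}{n^{\alpha}}.$$ -/

import Mathlib

open MeasureTheory ProbabilityTheory Filter Asymptotics
open scoped Nat ContDiff

/-- The supremum norm `sup_x |f x|` of a real function; it is only used for bounded functions. -/
noncomputable def supNorm (f : ℝ → ℝ) : ℝ := ⨆ x : ℝ, |f x|

/-- The class `C_b^∞(ℝ)`: smooth functions that are bounded together with all their derivatives. -/
def IsCbInfty (h : ℝ → ℝ) : Prop :=
  ContDiff ℝ ∞ h ∧ ∀ k : ℕ, ∃ M : ℝ, ∀ x : ℝ, |iteratedDeriv k h x| ≤ M

/-- The difference `E X^k - E Z^k` of the `k`-th moments of `X` and of a standard normal `Z`. -/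
noncomputable def momentDiff {Ω : Type*} [MeasurableSpace Ω] (P : Measure Ω) (X : Ω → ℝ)
    (k : ℕ) : ℝ :=
  (∫ w, X w ^ k ∂P) - ∫ z, z ^ k ∂(gaussianReal 0 1)

/-- The `k`-th term `‖h^(k+1)‖ / (k+1)! * |k ε_(k-1) - ε_(k+1)|` of the bound, for `k ≥ 1`. -/
noncomputable def boundTerm (h : ℝ → ℝ) (ε : ℕ → ℝ) (k : ℕ) : ℝ :=
  supNorm (iteratedDeriv (k + 1) h) / ((k + 1)! : ℝ) * |(k : ℝ) * ε (k - 1) - ε (k + 1)|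

/-- `g 0, g 1, …` are the successive derivatives of `g 0`, with `g k` bounded by `M k`. -/
structure DerivSeq (g : ℕ → ℝ → ℝ) (M : ℕ → ℝ) : Prop where
  hasDerivAt : ∀ k x, HasDerivAt (g k) (g (k + 1) x) x
  abs_le : ∀ k x, |g k x| ≤ M k

namespace DerivSeq

variable {g : ℕ → ℝ → ℝ} {M : ℕ → ℝ}

lemma continuous (hg : DerivSeq g M) (k : ℕ) : Continuous (g k) :=
  continuous_iff_continuousAt.2 fun x => (hg.hasDerivAt k x).continuousAt

lemma nonneg (hg : DerivSeq g M) (k : ℕ) : 0 ≤ M k := (abs_nonneg _).trans (hg.abs_le k 0)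

lemma shift (hg : DerivSeq g M) (m : ℕ) : DerivSeq (fun k => g (k + m)) (fun k => M (k + m)) where
  hasDerivAt k x := by
    have := hg.hasDerivAt (k + m) x
    rwa [show k + m + 1 = k + 1 + m by ring] at this
  abs_le k x := hg.abs_le _ _

lemma abs_le_of_abs_deriv_le {f f' : ℝ → ℝ} (hf : ∀ x, HasDerivAt f (f' x) x)
    (hc : Continuous f') (h0 : f 0 = 0) {B : ℝ} {N : ℕ}
    (hB : ∀ x, |f' x| ≤ B * |x| ^ N / N !) (x : ℝ) :
    |f x| ≤ B * |x| ^ (N + 1) / (N + 1)! := by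
  have hd : ∀ t ∈ Set.uIcc (0 : ℝ) 1, HasDerivAt (fun t => f (t * x)) (f' (t * x) * x) t := by
    intro t _
    have := (hf (t * x)).comp t ((hasDerivAt_id t).mul_const x)
    simpa [Function.comp_def] using this
  have hint := intervalIntegral.integral_eq_sub_of_hasDerivAt hd
    (Continuous.intervalIntegrable (by fun_prop) _ _)
  simp only [one_mul, zero_mul, h0, sub_zero] at hint
  rw [← hint, ← Real.norm_eq_abs]
  have hle := intervalIntegral.norm_integral_le_of_norm_le (a := 0) (b := 1) (μ := volume)
    (f := fun t => f' (t * x) * x) (g := fun t => B * |x| ^ (N + 1) / N ! * t ^ N) zero_le_one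
    (ae_of_all _ fun t ht => ?_) (Continuous.intervalIntegrable (by fun_prop) _ _)
  · refine hle.trans (le_of_eq ?_)
    rw [intervalIntegral.integral_const_mul, integral_pow, Nat.factorial_succ]
    push_cast
    field_simp
    simp
  · rw [Real.norm_eq_abs, abs_mul]
    have h1 := hB (t * x)
    rw [abs_mul, abs_of_pos ht.1, mul_pow] at h1
    calc |f' (t * x)| * |x| ≤ B * (t ^ N * |x| ^ N) / N ! * |x| := by gcongr
      _ = _ := by ring

/-- Taylor's theorem at the origin with a Lagrange-type bound on the remainder. -/
lemma abs_sub_taylor_le {B : ℝ} (N : ℕ) : ∀ {g : ℕ → ℝ → ℝ} {M : ℕ → ℝ}, DerivSeq g M →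
    (∀ x, |g N x| ≤ B) → ∀ x,
    |g 0 x - ∑ k ∈ Finset.range N, g k 0 * x ^ k / k !| ≤ B * |x| ^ N / N ! := by
  induction N with
  | zero => intro g M hg hB x; simpa using hB x
  | succ N ih =>
    intro g M hg hB x
    have hd : ∀ x, HasDerivAt
        (fun x => g 0 x - ∑ k ∈ Finset.range (N + 1), g k 0 * x ^ k / k !)
        (g 1 x - ∑ k ∈ Finset.range N, g (k + 1) 0 * x ^ k / k !) x := by
      intro x
      refine (hg.hasDerivAt 0 x).sub ?_
      have h1 : ∀ k ∈ Finset.range (N + 1), HasDerivAt (fun x : ℝ => g k 0 * x ^ k / k !)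
          (g k 0 * (k * x ^ (k - 1)) / k !) x := fun k _ =>
        ((hasDerivAt_pow k x).const_mul _).div_const _
      have h2 := HasDerivAt.fun_sum h1
      rw [Finset.sum_range_succ'] at h2
      convert! h2 using 1
      simp only [Nat.cast_zero, zero_mul, mul_zero, zero_div, add_zero]
      refine Finset.sum_congr rfl fun k _ => ?_
      rw [Nat.factorial_succ, Nat.add_sub_cancel]
      push_cast
      field_simp
    refine abs_le_of_abs_deriv_le hd ?_ ?_ (ih (hg.shift 1) hB) x
    · have := hg.continuous 1
      fun_prop
    · rw [Finset.sum_range_succ']; simp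

end DerivSeq

/-- Stein's lemma for the standard normal distribution. -/
lemma integral_mul_gaussianReal_eq_deriv {f f' : ℝ → ℝ} (hf : ∀ x, HasDerivAt f (f' x) x)
    (hc : Continuous f') {A B : ℝ} (hA : ∀ x, |f x| ≤ A) (hB : ∀ x, |f' x| ≤ B) :
    ∫ z, z * f z ∂(gaussianReal 0 1) = ∫ z, f' z ∂(gaussianReal 0 1) := by
  have hfc : Continuous f := continuous_iff_continuousAt.2 fun x => (hf x).continuousAt
  rw [integral_gaussianReal_eq_integral_smul one_ne_zero,
    integral_gaussianReal_eq_integral_smul one_ne_zero]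
  simp only [smul_eq_mul]
  have hp : ∀ x, HasDerivAt (gaussianPDFReal 0 1) (-(x * gaussianPDFReal 0 1 x)) x := by
    intro x
    have h1 : HasDerivAt (fun x : ℝ => -(x - 0) ^ 2 / (2 * ((1 : NNReal) : ℝ))) (-x) x := by
      have := (((hasDerivAt_id x).sub_const 0).pow 2).neg.div_const (2 * ((1 : NNReal) : ℝ))
      convert! this using 1
      simp
      ring
    have h2 := h1.exp.const_mul (√(2 * Real.pi * ((1 : NNReal) : ℝ)))⁻¹
    rw [gaussianPDFReal_def]
    convert! h2 using 1
    ring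
  have hpi : Integrable (gaussianPDFReal 0 1) := integrable_gaussianPDFReal 0 1
  have hxp : Integrable (fun x => -(x * gaussianPDFReal 0 1 x)) := by
    refine Integrable.neg ?_
    have := (integrable_mul_exp_neg_mul_sq (b := 1 / 2) (by norm_num)).const_mul
      (√(2 * Real.pi * ((1 : NNReal) : ℝ)))⁻¹
    convert! this using 2 with x
    simp only [gaussianPDFReal_def, NNReal.coe_one, sub_zero]
    ring_nf
  have key := integral_mul_deriv_eq_deriv_mul_of_integrable (u := f) (u' := f')
    (v := gaussianPDFReal 0 1) (v' := fun x => -(x * gaussianPDFReal 0 1 x))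
    (fun x _ => hf x) (fun x _ => hp x)
    (hxp.bdd_mul hfc.aestronglyMeasurable (ae_of_all _ hA))
    (hpi.bdd_mul hc.aestronglyMeasurable (ae_of_all _ hB))
    (hpi.bdd_mul hfc.aestronglyMeasurable (ae_of_all _ hA))
  have e1 : (fun x => gaussianPDFReal 0 1 x * (x * f x))
      = fun x => -(f x * -(x * gaussianPDFReal 0 1 x)) := by ext x; ring
  rw [e1, integral_neg, key, neg_neg]
  simp only [mul_comm]

lemma integrable_exp_mul_abs_gaussianReal (t : ℝ) :
    Integrable (fun z => Real.exp (t * |z|)) (gaussianReal 0 1) :=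
  integrable_exp_mul_abs (X := id) (integrable_exp_mul_gaussianReal t)
    (integrable_exp_mul_gaussianReal (-t))

lemma integrable_abs_pow_gaussianReal (k : ℕ) :
    Integrable (fun z : ℝ => |z| ^ k) (gaussianReal 0 1) :=
  integrable_pow_abs_of_integrable_exp_mul (X := id) one_ne_zero
    (integrable_exp_mul_gaussianReal 1) (integrable_exp_mul_gaussianReal (-1)) k

/-- The normal moments grow more slowly than `k! / A ^ k` for every `A`. -/
lemma exists_pow_mul_moment_gaussianReal_le (A : ℝ) (hA : 0 ≤ A) :
    ∃ D : ℝ, ∀ k : ℕ, A ^ k * (∫ z, |z| ^ k ∂(gaussianReal 0 1)) / k ! ≤ D * (1 / 2 : ℝ) ^ k := by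
  refine ⟨∫ z, Real.exp ((2 * A) * |z|) ∂(gaussianReal 0 1), fun k => ?_⟩
  have h : ∫ z, (2 * A) ^ k / k ! * |z| ^ k ∂(gaussianReal 0 1)
      ≤ ∫ z, Real.exp ((2 * A) * |z|) ∂(gaussianReal 0 1) := by
    refine integral_mono ((integrable_abs_pow_gaussianReal k).const_mul _)
      (integrable_exp_mul_abs_gaussianReal _) fun z => ?_
    have := Real.pow_div_factorial_le_exp (2 * A * |z|) (by positivity) k
    rw [mul_pow] at this
    calc _ = (2 * A) ^ k * |z| ^ k / k ! := by ring
      _ ≤ _ := this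
  rw [integral_const_mul, mul_pow] at h
  calc _ = (2 ^ k * A ^ k / k ! * ∫ z, |z| ^ k ∂(gaussianReal 0 1)) * (1 / 2 : ℝ) ^ k := by
        have : (2 : ℝ) ^ k * (1 / 2) ^ k = 1 := by rw [← mul_pow]; norm_num
        linear_combination (-(A ^ k * (∫ z, |z| ^ k ∂(gaussianReal 0 1)) / k !)) * this
    _ ≤ _ := by gcongr

namespace DerivSeq

variable {g : ℕ → ℝ → ℝ} {M : ℕ → ℝ}

/-- `θ ↦ E g_k (sin θ * Z)` has derivative `sin θ * cos θ * E g_(k+2) (sin θ * Z)`. -/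
lemma hasDerivAt_integral_gaussianReal (hg : DerivSeq g M) (k : ℕ) (θ : ℝ) :
    HasDerivAt (fun θ => ∫ z, g k (Real.sin θ * z) ∂(gaussianReal 0 1))
      (Real.sin θ * Real.cos θ * ∫ z, g (k + 2) (Real.sin θ * z) ∂(gaussianReal 0 1)) θ := by
  have hck := hg.continuous k
  have hck1 := hg.continuous (k + 1)
  have hck2 := hg.continuous (k + 2)
  have h := (hasDerivAt_integral_of_dominated_loc_of_deriv_le (μ := gaussianReal 0 1)
    (F := fun θ z => g k (Real.sin θ * z))
    (F' := fun θ z => g (k + 1) (Real.sin θ * z) * (Real.cos θ * z))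
    (bound := fun z => M (k + 1) * |z| ^ 1) (x₀ := θ) (s := Set.univ) univ_mem
    (Eventually.of_forall fun θ => Continuous.aestronglyMeasurable (by fun_prop))
    (Integrable.of_bound (Continuous.aestronglyMeasurable (by fun_prop)) (M k)
      (ae_of_all _ fun z => hg.abs_le k _))
    (Continuous.aestronglyMeasurable (by fun_prop))
    (ae_of_all _ fun z t _ => ?_)
    ((integrable_abs_pow_gaussianReal 1).const_mul _)
    (ae_of_all _ fun z t _ => ?_)).2
  · convert! h using 1
    have hs := integral_mul_gaussianReal_eq_deriv
      (f := fun z => g (k + 1) (Real.sin θ * z)) (f' := fun z => g (k + 2) (Real.sin θ * z) * Real.sin θ)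
      (A := M (k + 1)) (B := M (k + 2) * |Real.sin θ|)
      (fun z => by
        have := (hg.hasDerivAt (k + 1) (Real.sin θ * z)).comp z
          ((hasDerivAt_id z).const_mul (Real.sin θ))
        simpa [Function.comp_def] using this)
      (by fun_prop) (fun z => hg.abs_le _ _)
      (fun z => by rw [abs_mul]; gcongr; exact hg.abs_le _ _)
    rw [integral_mul_const] at hs
    calc _ = Real.cos θ * ((∫ z, g (k + 2) (Real.sin θ * z) ∂(gaussianReal 0 1)) * Real.sin θ) := by
          ring
      _ = _ := by
        rw [← hs, ← integral_const_mul]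
        congr 1 with z
        ring
  · rw [Real.norm_eq_abs, abs_mul, abs_mul, pow_one]
    have h1 := hg.abs_le (k + 1) (Real.sin t * z)
    have h2 := Real.abs_cos_le_one t
    calc _ ≤ M (k + 1) * (1 * |z|) := by
          have := hg.nonneg (k + 1)
          gcongr
      _ = _ := by ring
  · exact (hg.hasDerivAt k _).comp t ((Real.hasDerivAt_sin t).mul_const z)

/-- The `k`-th derivative at `0` of the solution `f` of the Stein equation
`f' x - x * f x = g 0 x - E g 0 Z`. -/
noncomputable def steinCoeff (g : ℕ → ℝ → ℝ) (k : ℕ) : ℝ :=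
  -∫ θ in (0 : ℝ)..(Real.pi / 2), Real.sin θ * Real.cos θ ^ k *
    ∫ z, g (k + 1) (Real.sin θ * z) ∂(gaussianReal 0 1)

lemma continuous_integral_gaussianReal (hg : DerivSeq g M) (k : ℕ) :
    Continuous (fun θ => ∫ z, g k (Real.sin θ * z) ∂(gaussianReal 0 1)) :=
  continuous_iff_continuousAt.2 fun θ => (hg.hasDerivAt_integral_gaussianReal k θ).continuousAt

lemma abs_steinCoeff_le (hg : DerivSeq g M) (k : ℕ) : |steinCoeff g k| ≤ M (k + 1) / (k + 1) := by
  have hint : ∫ θ in (0 : ℝ)..(Real.pi / 2), M (k + 1) * (Real.sin θ * Real.cos θ ^ k)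
      = M (k + 1) / (k + 1) := by
    have hd : ∀ θ ∈ Set.uIcc (0 : ℝ) (Real.pi / 2), HasDerivAt
        (fun θ => -(M (k + 1) / (k + 1) * Real.cos θ ^ (k + 1)))
        (M (k + 1) * (Real.sin θ * Real.cos θ ^ k)) θ := by
      intro θ _
      have := (((Real.hasDerivAt_cos θ).pow (k + 1)).const_mul (M (k + 1) / (k + 1))).neg
      convert! this using 1
      push_cast
      field_simp
    rw [intervalIntegral.integral_eq_sub_of_hasDerivAt hd
      (Continuous.intervalIntegrable (by fun_prop) _ _)]
    simp
  rw [steinCoeff, abs_neg, ← hint, ← Real.norm_eq_abs]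
  refine intervalIntegral.norm_integral_le_of_norm_le (by positivity)
    (ae_of_all _ fun θ hθ => ?_) (Continuous.intervalIntegrable (by fun_prop) _ _)
  have hs : 0 ≤ Real.sin θ :=
    Real.sin_nonneg_of_nonneg_of_le_pi hθ.1.le (by linarith [hθ.2, Real.pi_pos])
  have hco : 0 ≤ Real.cos θ :=
    Real.cos_nonneg_of_neg_pi_div_two_le_of_le (by linarith [hθ.1, Real.pi_pos]) hθ.2
  have hI : |∫ z, g (k + 1) (Real.sin θ * z) ∂(gaussianReal 0 1)| ≤ M (k + 1) := by
    have := norm_integral_le_of_norm_le_const (μ := gaussianReal 0 1)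
      (f := fun z => g (k + 1) (Real.sin θ * z)) (ae_of_all _ fun z => hg.abs_le (k + 1) _)
    simpa using this
  rw [Real.norm_eq_abs, abs_mul, abs_of_nonneg (by positivity), mul_comm]
  gcongr

lemma steinCoeff_sub (hg : DerivSeq g M) (k : ℕ) :
    steinCoeff g (k + 2) - (k + 1) * steinCoeff g k = g (k + 1) 0 := by
  have hc1 := hg.continuous_integral_gaussianReal (k + 1)
  have hc3 := hg.continuous_integral_gaussianReal (k + 3)
  have hd : ∀ θ ∈ Set.uIcc (0 : ℝ) (Real.pi / 2), HasDerivAt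
      (fun θ => Real.cos θ ^ (k + 1) * ∫ z, g (k + 1) (Real.sin θ * z) ∂(gaussianReal 0 1))
      (Real.sin θ * Real.cos θ ^ (k + 2) * (∫ z, g (k + 3) (Real.sin θ * z) ∂(gaussianReal 0 1))
        - (k + 1) * (Real.sin θ * Real.cos θ ^ k *
          ∫ z, g (k + 1) (Real.sin θ * z) ∂(gaussianReal 0 1))) θ := by
    intro θ _
    have := ((Real.hasDerivAt_cos θ).pow (k + 1)).mul (hg.hasDerivAt_integral_gaussianReal (k + 1) θ)
    convert! this using 1
    push_cast
    simp only [Pi.pow_apply]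
    ring
  have h := intervalIntegral.integral_eq_sub_of_hasDerivAt hd
    (Continuous.intervalIntegrable (by fun_prop) _ _)
  rw [intervalIntegral.integral_sub (Continuous.intervalIntegrable (by fun_prop) _ _)
    (Continuous.intervalIntegrable (by fun_prop) _ _), intervalIntegral.integral_const_mul] at h
  simp only [Real.cos_pi_div_two, Real.cos_zero, Real.sin_zero, zero_mul, one_pow, one_mul,
    integral_const, probReal_univ, smul_eq_mul, zero_pow (Nat.succ_ne_zero k)] at h
  simp only [steinCoeff]
  linarith

end DerivSeq

lemma integrable_pow_of_abs_pow {Ω : Type*} [MeasurableSpace Ω] {P : Measure Ω} {X : Ω → ℝ}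
    (hX : AEMeasurable X P) {k : ℕ} (hk : Integrable (fun w => |X w| ^ k) P) :
    Integrable (fun w => X w ^ k) P := by
  refine hk.mono (hX.pow_const k).aestronglyMeasurable (ae_of_all _ fun w => ?_)
  simp

lemma momentDiff_zero {Ω : Type*} [MeasurableSpace Ω] (P : Measure Ω) [IsProbabilityMeasure P]
    (X : Ω → ℝ) : momentDiff P X 0 = 0 := by
  simp [momentDiff]

namespace DerivSeq

variable {g : ℕ → ℝ → ℝ} {M : ℕ → ℝ}

lemma integrable_comp (hg : DerivSeq g M) {Ω : Type*} [MeasurableSpace Ω] {P : Measure Ω}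
    [IsProbabilityMeasure P] {X : Ω → ℝ} (hX : AEMeasurable X P) (k : ℕ) :
    Integrable (fun w => g k (X w)) P :=
  Integrable.of_bound ((hg.continuous k).measurable.comp_aemeasurable hX).aestronglyMeasurable (M k)
    (ae_of_all _ fun _ => hg.abs_le k _)

lemma abs_integral_sub_taylor_le (hg : DerivSeq g M) {Ω : Type*} [MeasurableSpace Ω]
    {P : Measure Ω} [IsProbabilityMeasure P] {X : Ω → ℝ} (hX : AEMeasurable X P)
    (hint : ∀ k, Integrable (fun w => |X w| ^ k) P) {N : ℕ} {B : ℝ} (hB : ∀ x, |g N x| ≤ B) :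
    |(∫ w, g 0 (X w) ∂P) - ∑ k ∈ Finset.range N, g k 0 / k ! * ∫ w, X w ^ k ∂P|
      ≤ B * (∫ w, |X w| ^ N ∂P) / N ! := by
  have hi : ∀ k ∈ Finset.range N, Integrable (fun w => g k 0 / k ! * X w ^ k) P := fun k _ =>
    (integrable_pow_of_abs_pow hX (hint k)).const_mul _
  simp_rw [← integral_const_mul]
  rw [← integral_finsetSum _ hi, ← integral_sub (hg.integrable_comp hX 0) (integrable_finsetSum _ hi),
    ← Real.norm_eq_abs]
  calc _ ≤ ∫ w, B / N ! * |X w| ^ N ∂P := by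
        refine norm_integral_le_of_norm_le ((hint N).const_mul _) (ae_of_all _ fun w => ?_)
        have := abs_sub_taylor_le N hg hB (X w)
        rw [Real.norm_eq_abs]
        convert! this using 1
        · congr 2
          exact Finset.sum_congr rfl fun k _ => by ring
        · ring
    _ = _ := by rw [integral_const_mul, integral_const_mul]; ring

/-- Summation by parts of the Taylor polynomial along the Stein recursion. -/
lemma sum_taylor_eq (hg : DerivSeq g M) {ε : ℕ → ℝ} (h0 : ε 0 = 0) (N : ℕ) :
    ∑ k ∈ Finset.range (N + 1), g (k + 1) 0 / (k + 1)! * ε (k + 1)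
      = -(steinCoeff g 0 * ε 1)
        + ∑ j ∈ Finset.range N, steinCoeff g (j + 1) / (j + 1)! * ((j + 1) * ε j - ε (j + 2))
        + steinCoeff g (N + 1) * ε N / N ! + steinCoeff g (N + 2) * ε (N + 1) / (N + 1)! := by
  induction N with
  | zero =>
    rw [Finset.sum_range_one, ← hg.steinCoeff_sub]
    simp [h0]
    ring
  | succ N ih =>
    rw [Finset.sum_range_succ, ih, ← hg.steinCoeff_sub, Finset.sum_range_succ]
    rw [show (N + 1 + 1)! = (N + 2) * ((N + 1) * N !) by
      rw [Nat.factorial_succ, Nat.factorial_succ], Nat.factorial_succ]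
    push_cast
    field_simp
    ring

lemma abs_sum_taylor_le (hg : DerivSeq g M) {ε : ℕ → ℝ} (h0 : ε 0 = 0) {C : ℝ}
    (hε : ∀ k, 1 ≤ k → M (k + 2) * |ε k| ≤ C * (k - 1)!) {N : ℕ} (hN : 1 ≤ N) :
    |∑ k ∈ Finset.range (N + 1), g (k + 1) 0 / (k + 1)! * ε (k + 1)|
      ≤ M 1 * |ε 1| + ∑ j ∈ Finset.range N, M (j + 2) / (j + 2)! * |(j + 1) * ε j - ε (j + 2)|
        + C / N + C / N := by
  have hb : ∀ k, 1 ≤ k → |steinCoeff g (k + 1) * ε k / k !| ≤ C / k := by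
    intro k hk
    obtain ⟨m, rfl⟩ := Nat.exists_eq_add_of_le' hk
    have h1 := hg.abs_steinCoeff_le (m + 1 + 1)
    have h2 := hε (m + 1) hk
    rw [Nat.add_sub_cancel] at h2
    have h3 : |steinCoeff g (m + 1 + 1)| ≤ M (m + 1 + 2) := h1.trans
      (div_le_self (hg.nonneg _) (by push_cast; linarith [(Nat.cast_nonneg m : (0 : ℝ) ≤ m)]))
    rw [abs_div, abs_mul, Nat.abs_cast, Nat.factorial_succ]
    calc _ ≤ M (m + 1 + 2) * |ε (m + 1)| / ((m + 1) * m ! : ℕ) := by gcongr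
      _ ≤ C * m ! / ((m + 1) * m ! : ℕ) := by gcongr
      _ = _ := by push_cast; field_simp
  have hC : 0 ≤ C := by
    have := hε 1 le_rfl
    simp only [Nat.sub_self, Nat.factorial_zero, Nat.cast_one, mul_one] at this
    exact (mul_nonneg (hg.nonneg _) (abs_nonneg _)).trans this
  rw [hg.sum_taylor_eq h0]
  refine (abs_add_le _ _).trans (add_le_add ((abs_add_le _ _).trans (add_le_add
    ((abs_add_le _ _).trans (add_le_add ?_ ?_)) (hb N hN))) ((hb (N + 1) (by omega)).trans ?_))
  · rw [abs_neg, abs_mul]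
    have := hg.abs_steinCoeff_le 0
    simp only [Nat.cast_zero, zero_add, div_one] at this
    gcongr
  · refine (Finset.abs_sum_le_sum_abs _ _).trans (Finset.sum_le_sum fun j _ => ?_)
    rw [abs_mul, abs_div, Nat.abs_cast]
    have := hg.abs_steinCoeff_le (j + 1)
    calc _ ≤ M (j + 1 + 1) / ((j + 1 : ℕ) + 1) / (j + 1)! * |(j + 1) * ε j - ε (j + 2)| := by
          gcongr
      _ = _ := by
        rw [show (j + 2)! = (j + 2) * (j + 1)! from Nat.factorial_succ _]
        push_cast
        field_simp
        ring
  · gcongr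
    simp

/-- The Stein series bound for functions whose derivatives grow at most geometrically, up to a
polynomial factor. -/
lemma abs_integral_sub_le_of_geometric (hg : DerivSeq g M) {A B : ℝ} (hA : 0 ≤ A)
    (hL : ∀ k x, |g k x| ≤ B * (k + 1) ^ 2 * A ^ k)
    {Ω : Type*} [MeasurableSpace Ω] {P : Measure Ω} [IsProbabilityMeasure P] {X : Ω → ℝ}
    (hX : AEMeasurable X P) (hint : ∀ k, Integrable (fun w => |X w| ^ k) P) {C : ℝ}
    (hε : ∀ k, 1 ≤ k → M k * |momentDiff P X k| ≤ C * (k - 1)!)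
    (hε' : ∀ k, 1 ≤ k → M (k + 2) * |momentDiff P X k| ≤ C * (k - 1)!) {T : ℝ}
    (hT : ∀ N, M 1 * |momentDiff P X 1| + ∑ j ∈ Finset.range N,
      M (j + 2) / (j + 2)! * |(j + 1) * momentDiff P X j - momentDiff P X (j + 2)| ≤ T) :
    |(∫ w, g 0 (X w) ∂P) - ∫ z, g 0 z ∂(gaussianReal 0 1)| ≤ T := by
  obtain ⟨D, hD⟩ := exists_pow_mul_moment_gaussianReal_le A hA
  have hB0 : 0 ≤ B := by
    have := (abs_nonneg _).trans (hL 0 0)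
    simpa using this
  have hC : 0 ≤ C := by
    have := hε 1 le_rfl
    simp only [Nat.sub_self, Nat.factorial_zero, Nat.cast_one, mul_one] at this
    exact (mul_nonneg (hg.nonneg _) (abs_nonneg _)).trans this
  have key : ∀ m : ℕ, 1 ≤ m → |(∫ w, g 0 (X w) ∂P) - ∫ z, g 0 z ∂(gaussianReal 0 1)|
      ≤ T + 3 * C / m + 4 * B * D * (((2 * m + 3 : ℕ) : ℝ) ^ 2 * (1 / 2) ^ (2 * m + 3)) := by
    intro m hm
    set N := 2 * m with hN
    have hb : ∀ x, |g (N + 2) x| ≤ min (M (N + 2)) (B * ((N + 2 : ℕ) + 1) ^ 2 * A ^ (N + 2)) :=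
      fun x => le_min (hg.abs_le _ x) (hL _ x)
    set b := min (M (N + 2)) (B * ((N + 2 : ℕ) + 1) ^ 2 * A ^ (N + 2))
    have hb0 : 0 ≤ b := (abs_nonneg _).trans (hb 0)
    have hT1 := hg.abs_integral_sub_taylor_le hX hint hb
    have hT2 := hg.abs_integral_sub_taylor_le (P := gaussianReal 0 1) (X := fun z => z)
      aemeasurable_id integrable_abs_pow_gaussianReal hb
    have hS := hg.abs_sum_taylor_le (momentDiff_zero P X) hε' (N := N) (by omega)
    have hev : Even (N + 2) := by rw [hN]; exact ⟨m + 1, by ring⟩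
    have hsum : ∑ k ∈ Finset.range (N + 2), g k 0 / k ! * ∫ w, X w ^ k ∂P
        - ∑ k ∈ Finset.range (N + 2), g k 0 / k ! * ∫ z, z ^ k ∂(gaussianReal 0 1)
        = ∑ k ∈ Finset.range (N + 1), g (k + 1) 0 / (k + 1)! * momentDiff P X (k + 1) := by
      rw [← Finset.sum_sub_distrib, Finset.sum_range_succ']
      simp only [← mul_sub, momentDiff]
      simp
    have hmom : ∫ w, |X w| ^ (N + 2) ∂P
        = momentDiff P X (N + 2) + ∫ z, |z| ^ (N + 2) ∂(gaussianReal 0 1) := by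
      simp only [hev.pow_abs, momentDiff]
      ring
    have hm0 : 0 ≤ ∫ z, |z| ^ (N + 2) ∂(gaussianReal 0 1) := integral_nonneg fun z => by positivity
    have e1 : b * momentDiff P X (N + 2) / (N + 2)! ≤ C / m := by
      have h1 : b * |momentDiff P X (N + 2)| ≤ C * (N + 1)! :=
        (mul_le_mul_of_nonneg_right (min_le_left _ _) (abs_nonneg _)).trans
          (hε (N + 2) (by omega))
      calc _ ≤ b * |momentDiff P X (N + 2)| / (N + 2)! := by gcongr; exact le_abs_self _
        _ ≤ C * (N + 1)! / (N + 2)! := by gcongr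
        _ = C / (N + 2) := by
          rw [show (N + 2)! = (N + 2) * (N + 1)! from Nat.factorial_succ _]
          push_cast
          field_simp
        _ ≤ C / m := by
          gcongr
          rw [hN]; push_cast; linarith [(Nat.cast_nonneg m : (0 : ℝ) ≤ m)]
    have e2 : b * (∫ z, |z| ^ (N + 2) ∂(gaussianReal 0 1)) / (N + 2)!
        ≤ 2 * B * D * (((N + 3 : ℕ) : ℝ) ^ 2 * (1 / 2) ^ (N + 3)) := by
      calc _ ≤ B * ((N + 2 : ℕ) + 1) ^ 2 * A ^ (N + 2) *
            (∫ z, |z| ^ (N + 2) ∂(gaussianReal 0 1)) / (N + 2)! := by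
            gcongr
            exact min_le_right _ _
        _ = B * ((N + 2 : ℕ) + 1) ^ 2 * (A ^ (N + 2) *
            (∫ z, |z| ^ (N + 2) ∂(gaussianReal 0 1)) / (N + 2)!) := by ring
        _ ≤ B * ((N + 2 : ℕ) + 1) ^ 2 * (D * (1 / 2) ^ (N + 2)) := by gcongr; exact hD _
        _ = _ := by push_cast; ring
    have e3 : C / N ≤ C / m := by
      have : (0 : ℝ) < m := by exact_mod_cast hm
      gcongr
      rw [hN]; linarith
    rw [hmom] at hT1
    have hTN := hT N
    rw [← hsum] at hS
    rw [mul_add, add_div] at hT1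
    have e4 : 3 * C / m = C / m + C / m + C / m := by ring
    rw [_root_.abs_le] at hT1 hT2 hS ⊢
    constructor <;> linarith [hT1.1, hT1.2, hT2.1, hT2.2, hS.1, hS.2]
  have hlim : Tendsto (fun m : ℕ => T + 3 * C / m
      + 4 * B * D * (((2 * m + 3 : ℕ) : ℝ) ^ 2 * (1 / 2) ^ (2 * m + 3))) atTop (nhds T) := by
    have h1 := tendsto_const_div_atTop_nhds_zero_nat (3 * C)
    have h2 := (tendsto_pow_const_mul_const_pow_of_abs_lt_one 2 (r := (1 / 2 : ℝ))
      (by norm_num [abs_of_pos])).comp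
      (tendsto_atTop_mono (fun m : ℕ => (by omega : m ≤ 2 * m + 3)) tendsto_id)
    have h3 := (tendsto_const_nhds (x := T)).add h1 |>.add (h2.const_mul (4 * B * D))
    simpa [Function.comp_def] using h3
  exact ge_of_tendsto hlim (eventually_atTop.2 ⟨1, key⟩)

end DerivSeq

/-- The `k`-th derivative of the Fejér kernel `(1 - cos x) / x ^ 2 = ∫ t in 0..1, (1 - t) cos (t x)`. -/
noncomputable def fejer (k : ℕ) (x : ℝ) : ℝ :=
  ∫ t in (0 : ℝ)..1, (t ^ k - t ^ (k + 1)) * Real.cos (t * x + k * (Real.pi / 2))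

lemma pow_sub_pow_succ_mem {t : ℝ} (h0 : 0 ≤ t) (h1 : t ≤ 1) (k : ℕ) :
    0 ≤ t ^ k - t ^ (k + 1) ∧ t ^ k - t ^ (k + 1) ≤ 1 := by
  have h2 : t ^ k ≤ 1 := pow_le_one₀ h0 h1
  have h3 : 0 ≤ t ^ (k + 1) := by positivity
  exact ⟨sub_nonneg.2 (pow_le_pow_of_le_one h0 h1 (Nat.le_succ k)), by linarith⟩

lemma norm_fejer_integrand_le {t : ℝ} (ht : t ∈ Set.uIoc (0 : ℝ) 1) (k : ℕ) (y : ℝ) :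
    ‖(t ^ k - t ^ (k + 1)) * Real.cos y‖ ≤ 1 := by
  rw [Set.uIoc_of_le zero_le_one] at ht
  obtain ⟨h1, h2⟩ := pow_sub_pow_succ_mem ht.1.le ht.2 k
  rw [Real.norm_eq_abs, abs_mul, abs_of_nonneg h1]
  exact mul_le_one₀ h2 (abs_nonneg _) (Real.abs_cos_le_one _)

lemma derivSeq_fejer : DerivSeq fejer (fun _ => 1) where
  abs_le k x := by
    have := intervalIntegral.norm_integral_le_of_norm_le_const (a := 0) (b := 1) (C := 1)
      (f := fun t => (t ^ k - t ^ (k + 1)) * Real.cos (t * x + k * (Real.pi / 2)))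
      fun t ht => norm_fejer_integrand_le ht k _
    simpa [fejer] using this
  hasDerivAt k x := by
    refine (intervalIntegral.hasDerivAt_integral_of_dominated_loc_of_deriv_le
      (F := fun x t => (t ^ k - t ^ (k + 1)) * Real.cos (t * x + k * (Real.pi / 2)))
      (F' := fun x t => (t ^ (k + 1) - t ^ (k + 1 + 1)) *
        Real.cos (t * x + (k + 1 : ℕ) * (Real.pi / 2)))
      (bound := fun _ => 1) (s := Set.univ) univ_mem
      (Eventually.of_forall fun x => Continuous.aestronglyMeasurable (by fun_prop))
      (Continuous.intervalIntegrable (by fun_prop) _ _)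
      (Continuous.aestronglyMeasurable (by fun_prop))
      (ae_of_all _ fun t ht x _ => norm_fejer_integrand_le ht _ _)
      (Continuous.intervalIntegrable (by fun_prop) _ _)
      (ae_of_all _ fun t _ x _ => ?_)).2
    have h1 := (((hasDerivAt_id x).const_mul t).add_const (k * (Real.pi / 2))).cos.const_mul
      (t ^ k - t ^ (k + 1))
    convert! h1 using 1
    rw [show t * x + ((k + 1 : ℕ) : ℝ) * (Real.pi / 2) = t * x + k * (Real.pi / 2) + Real.pi / 2 by
      push_cast; ring, Real.cos_add_pi_div_two]
    simp only [id]
    ring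

lemma sq_mul_fejer_zero (x : ℝ) : x ^ 2 * fejer 0 x = 1 - Real.cos x := by
  have hd : ∀ t ∈ Set.uIcc (0 : ℝ) 1, HasDerivAt
      (fun t => (1 - t) * x * Real.sin (t * x) - Real.cos (t * x))
      (x ^ 2 * ((t ^ 0 - t ^ (0 + 1)) * Real.cos (t * x + (0 : ℕ) * (Real.pi / 2)))) t := by
    intro t _
    have hx := (hasDerivAt_id t).mul_const x
    have := ((((hasDerivAt_id t).const_sub 1).mul_const x).mul hx.sin).sub hx.cos
    convert! this using 1
    simp
    ring
  have h := intervalIntegral.integral_eq_sub_of_hasDerivAt hd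
    (Continuous.intervalIntegrable (by fun_prop) _ _)
  rw [intervalIntegral.integral_const_mul] at h
  rw [fejer, h]
  simp
  ring

lemma fejer_zero_pos : 0 < fejer 0 0 := by
  have : fejer 0 0 = 1 / 2 := by
    simp only [fejer]
    simp only [pow_zero, zero_add, pow_one, mul_zero, Nat.cast_zero, zero_mul, Real.cos_zero,
      mul_one]
    rw [intervalIntegral.integral_sub (by simp) (by simp), integral_id]
    norm_num
  rw [this]; norm_num

lemma fejer_nonneg (x : ℝ) : 0 ≤ fejer 0 x := by
  rcases eq_or_ne x 0 with rfl | hx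
  · exact fejer_zero_pos.le
  · have h := sq_mul_fejer_zero x
    have h2 : 0 ≤ x ^ 2 * fejer 0 x := by rw [h]; linarith [Real.cos_le_one x]
    exact nonneg_of_mul_nonneg_right h2 (by positivity)

lemma sq_mul_abs_fejer_le (k : ℕ) (x : ℝ) : x ^ 2 * |fejer k x| ≤ 4 * (k + 1) ^ 2 := by
  set θ : ℝ := k * (Real.pi / 2) with hθ
  set w₁ : ℝ → ℝ := fun t => k * t ^ (k - 1) - (k + 1 : ℕ) * t ^ k with hw₁
  set w₂ : ℝ → ℝ := fun t => k * ((k - 1 : ℕ) * t ^ (k - 1 - 1)) - (k + 1 : ℕ) * (k * t ^ (k - 1))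
    with hw₂
  have hk0 : (0 : ℝ) ≤ k := Nat.cast_nonneg k
  have hk1 : ((k - 1 : ℕ) : ℝ) ≤ k := by exact_mod_cast Nat.sub_le k 1
  have hw₁le : ∀ t ∈ Set.Icc (0 : ℝ) 1, |w₁ t| ≤ k + 1 := by
    intro t ht
    have h1 : t ^ (k - 1) ≤ 1 := pow_le_one₀ ht.1 ht.2
    have h2 : t ^ k ≤ 1 := pow_le_one₀ ht.1 ht.2
    have h3 : 0 ≤ t ^ (k - 1) := pow_nonneg ht.1 _
    have h4 : 0 ≤ t ^ k := pow_nonneg ht.1 _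
    simp only [hw₁]
    push_cast
    rw [abs_le]
    constructor <;> nlinarith
  have hw₂le : ∀ t ∈ Set.Icc (0 : ℝ) 1, |w₂ t| ≤ (k + 1) * k := by
    intro t ht
    have h1 : t ^ (k - 1) ≤ 1 := pow_le_one₀ ht.1 ht.2
    have h2 : t ^ (k - 1 - 1) ≤ 1 := pow_le_one₀ ht.1 ht.2
    have h3 : 0 ≤ t ^ (k - 1) := pow_nonneg ht.1 _
    have h4 : 0 ≤ t ^ (k - 1 - 1) := pow_nonneg ht.1 _
    have h5 : (k : ℝ) * ((k - 1 : ℕ) * t ^ (k - 1 - 1)) ≤ (k + 1) * k := by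
      calc (k : ℝ) * ((k - 1 : ℕ) * t ^ (k - 1 - 1)) ≤ k * (k * 1) := by gcongr
        _ ≤ _ := by nlinarith
    have h6 : ((k : ℝ) + 1) * (k * t ^ (k - 1)) ≤ (k + 1) * k := by
      calc _ ≤ ((k : ℝ) + 1) * (k * 1) := by gcongr
        _ = _ := by ring
    have h7 : 0 ≤ (k : ℝ) * ((k - 1 : ℕ) * t ^ (k - 1 - 1)) := by positivity
    have h8 : 0 ≤ ((k : ℝ) + 1) * (k * t ^ (k - 1)) := by positivity
    simp only [hw₂]
    push_cast
    rw [abs_le]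
    constructor <;> linarith
  have hd : ∀ t ∈ Set.uIcc (0 : ℝ) 1, HasDerivAt
      (fun t => (t ^ k - t ^ (k + 1)) * x * Real.sin (t * x + θ) + w₁ t * Real.cos (t * x + θ))
      (x ^ 2 * ((t ^ k - t ^ (k + 1)) * Real.cos (t * x + θ)) + w₂ t * Real.cos (t * x + θ)) t := by
    intro t _
    have hx := ((hasDerivAt_id t).mul_const x).add_const θ
    have h1 : HasDerivAt w₁ (w₂ t) t :=
      ((hasDerivAt_pow (k - 1) t).const_mul _).sub ((hasDerivAt_pow k t).const_mul _)
    have h0 : HasDerivAt (fun t : ℝ => t ^ k - t ^ (k + 1)) (w₁ t) t :=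
      (hasDerivAt_pow k t).sub (hasDerivAt_pow (k + 1) t)
    have := ((h0.mul_const x).mul hx.sin).add (h1.mul hx.cos)
    convert! this using 1
    simp only [id]
    ring
  have hc₂ : Continuous w₂ := by fun_prop
  have h := intervalIntegral.integral_eq_sub_of_hasDerivAt hd
    (Continuous.intervalIntegrable (by fun_prop) _ _)
  rw [intervalIntegral.integral_add (Continuous.intervalIntegrable (by fun_prop) _ _)
    (Continuous.intervalIntegrable (by fun_prop) _ _), intervalIntegral.integral_const_mul] at h
  have hz : ((0 : ℝ) ^ k - 0 ^ (k + 1)) * x * Real.sin (0 * x + θ) = 0 := by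
    rcases Nat.eq_zero_or_pos k with rfl | hk
    · simp [hθ]
    · simp [hk.ne']
  have hI : |∫ t in (0 : ℝ)..1, w₂ t * Real.cos (t * x + θ)| ≤ (k + 1) * k := by
    have := intervalIntegral.norm_integral_le_of_norm_le_const (a := 0) (b := 1)
      (C := ((k : ℝ) + 1) * k) (f := fun t => w₂ t * Real.cos (t * x + θ)) fun t ht => by
        rw [Set.uIoc_of_le zero_le_one] at ht
        rw [Real.norm_eq_abs, abs_mul]
        exact (mul_le_of_le_one_right (abs_nonneg _) (Real.abs_cos_le_one _)).trans
          (hw₂le t ⟨ht.1.le, ht.2⟩)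
    simpa using this
  have hb : ∀ t ∈ Set.Icc (0 : ℝ) 1, |w₁ t * Real.cos (t * x + θ)| ≤ k + 1 := fun t ht => by
    rw [abs_mul]
    exact (mul_le_of_le_one_right (abs_nonneg _) (Real.abs_cos_le_one _)).trans (hw₁le t ht)
  have hb1 := hb 1 (by simp)
  have hb0 := hb 0 (by simp)
  have hx2 : x ^ 2 * |fejer k x| = |x ^ 2 * fejer k x| := by
    rw [abs_mul, abs_of_nonneg (sq_nonneg x)]
  rw [hx2, fejer, ← hθ, eq_sub_of_add_eq h, hz]
  simp only [one_pow, sub_self, zero_mul, zero_add] at *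
  refine (abs_sub _ _).trans ((add_le_add ((abs_sub _ _).trans (add_le_add hb1 hb0)) hI).trans ?_)
  nlinarith

lemma abs_fejer_le (k : ℕ) (x : ℝ) : |fejer k x| ≤ 5 * (k + 1) ^ 2 * (1 + x ^ 2)⁻¹ := by
  have h1 := sq_mul_abs_fejer_le k x
  have h2 := derivSeq_fejer.abs_le k x
  have hk0 : (0 : ℝ) ≤ k := Nat.cast_nonneg k
  rw [← div_eq_mul_inv, le_div_iff₀ (by positivity)]
  nlinarith

lemma integrable_fejer (k : ℕ) : Integrable (fejer k) :=
  (integrable_inv_one_add_sq.const_mul (5 * ((k : ℝ) + 1) ^ 2)).mono'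
    (derivSeq_fejer.continuous k).aestronglyMeasurable (ae_of_all _ (abs_fejer_le k))

lemma integral_fejer_pos : 0 < ∫ y, fejer 0 y :=
  integral_pos_of_integrable_nonneg_nonzero (derivSeq_fejer.continuous 0) (integrable_fejer 0)
    fejer_nonneg fejer_zero_pos.ne'

lemma integral_abs_fejer_le (k : ℕ) :
    ∫ y, |fejer k y| ≤ 5 * (k + 1) ^ 2 * ∫ y : ℝ, (1 + y ^ 2)⁻¹ := by
  rw [← integral_const_mul]
  exact integral_mono (integrable_fejer k).abs (integrable_inv_one_add_sq.const_mul _)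
    (abs_fejer_le k)

namespace DerivSeq

variable {g : ℕ → ℝ → ℝ} {M : ℕ → ℝ}

/-- The average of `g k` against the Fejér kernel at scale `σ`. -/
noncomputable def fejerMean (g : ℕ → ℝ → ℝ) (σ : ℝ) (k : ℕ) (x : ℝ) : ℝ :=
  (∫ y, fejer 0 y)⁻¹ * ∫ y, g k (x + σ * y) * fejer 0 y

lemma integrable_mul_fejer (hg : DerivSeq g M) (σ x : ℝ) (k j : ℕ) :
    Integrable (fun y => g k (x + σ * y) * fejer j y) :=
  (integrable_fejer j).bdd_mul (Continuous.aestronglyMeasurable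
    (by have := hg.continuous k; fun_prop)) (ae_of_all _ fun y => hg.abs_le k _)

lemma abs_integral_mul_fejer_le (hg : DerivSeq g M) (σ x : ℝ) (k j : ℕ) :
    |∫ y, g k (x + σ * y) * fejer j y| ≤ M k * ∫ y, |fejer j y| := by
  rw [← integral_const_mul, ← Real.norm_eq_abs]
  refine norm_integral_le_of_norm_le ((integrable_fejer j).abs.const_mul _) (ae_of_all _ fun y => ?_)
  rw [Real.norm_eq_abs, abs_mul]
  gcongr
  exact hg.abs_le k _

lemma fejerMean_derivSeq (hg : DerivSeq g M) (σ : ℝ) : DerivSeq (fejerMean g σ) M where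
  abs_le k x := by
    have h := hg.abs_integral_mul_fejer_le σ x k 0
    simp only [abs_of_nonneg (fejer_nonneg _)] at h
    rw [fejerMean, abs_mul, abs_of_pos (inv_pos.2 integral_fejer_pos),
      inv_mul_le_iff₀ integral_fejer_pos]
    linarith
  hasDerivAt k x := by
    have hck := hg.continuous k
    have hck1 := hg.continuous (k + 1)
    have hcf := derivSeq_fejer.continuous 0
    refine ((hasDerivAt_integral_of_dominated_loc_of_deriv_le
      (F := fun x y => g k (x + σ * y) * fejer 0 y)
      (F' := fun x y => g (k + 1) (x + σ * y) * fejer 0 y)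
      (bound := fun y => M (k + 1) * |fejer 0 y|) (s := Set.univ) univ_mem
      (Eventually.of_forall fun x => Continuous.aestronglyMeasurable (by fun_prop))
      (hg.integrable_mul_fejer σ x k 0)
      (Continuous.aestronglyMeasurable (by fun_prop))
      (ae_of_all _ fun y x _ => ?_)
      ((integrable_fejer 0).abs.const_mul _)
      (ae_of_all _ fun y x _ => ?_)).2).const_mul _
    · rw [Real.norm_eq_abs, abs_mul]
      gcongr
      exact hg.abs_le _ _
    · have := ((hg.hasDerivAt k (x + σ * y)).comp x ((hasDerivAt_id x).add_const (σ * y))).mul_const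
        (fejer 0 y)
      simpa [Function.comp_def] using this

lemma pow_mul_integral_mul_fejer (hg : DerivSeq g M) (σ x : ℝ) (k : ℕ) : ∀ j : ℕ,
    σ ^ k * ∫ y, g k (x + σ * y) * fejer j y
      = (-1) ^ k * ∫ y, g 0 (x + σ * y) * fejer (j + k) y := by
  induction k with
  | zero => intro j; simp
  | succ k ih =>
    intro j
    have h := integral_mul_deriv_eq_deriv_mul_of_integrable (u := fun y => g k (x + σ * y))
      (u' := fun y => g (k + 1) (x + σ * y) * σ) (v := fejer j) (v' := fejer (j + 1))
      (fun y _ => by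
        have := (hg.hasDerivAt k (x + σ * y)).comp y (((hasDerivAt_id y).const_mul σ).const_add x)
        simpa [Function.comp_def] using this)
      (fun y _ => derivSeq_fejer.hasDerivAt j y)
      (hg.integrable_mul_fejer σ x k (j + 1))
      (by
        have := (hg.integrable_mul_fejer σ x (k + 1) j).const_mul σ
        convert! this using 2 with y
        simp only [Pi.mul_apply]
        ring)
      (hg.integrable_mul_fejer σ x k j)
    have e : ∫ y, g (k + 1) (x + σ * y) * σ * fejer j y
        = σ * ∫ y, g (k + 1) (x + σ * y) * fejer j y := by
      rw [← integral_const_mul]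
      congr 1 with y
      ring
    have h2 := ih (j + 1)
    rw [h, e, show j + 1 + k = j + (k + 1) by ring] at h2
    rw [pow_succ (-1 : ℝ) k]
    linear_combination -h2

lemma abs_fejerMean_le (hg : DerivSeq g M) {σ : ℝ} (hσ : 0 < σ) (k : ℕ) (x : ℝ) :
    |fejerMean g σ k x| ≤ ((∫ y, fejer 0 y)⁻¹ * M 0 * 5 * ∫ y : ℝ, (1 + y ^ 2)⁻¹)
      * (k + 1) ^ 2 * σ⁻¹ ^ k := by
  have h := hg.pow_mul_integral_mul_fejer σ x k 0
  have h1 := (hg.abs_integral_mul_fejer_le σ x 0 (0 + k)).trans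
    (mul_le_mul_of_nonneg_left (integral_abs_fejer_le (0 + k)) (hg.nonneg 0))
  rw [zero_add] at h1 h
  have h2 : |∫ y, g k (x + σ * y) * fejer 0 y|
      = |∫ y, g 0 (x + σ * y) * fejer k y| * σ⁻¹ ^ k := by
    have h3 := congrArg abs h
    rw [abs_mul, abs_mul, abs_pow, abs_pow, abs_neg, abs_one, one_pow, one_mul,
      abs_of_pos hσ] at h3
    rw [← h3, inv_pow]
    field_simp
  rw [fejerMean, abs_mul, abs_of_pos (inv_pos.2 integral_fejer_pos), h2]
  have hc := inv_pos.2 integral_fejer_pos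
  calc _ ≤ (∫ y, fejer 0 y)⁻¹ *
        (M 0 * (5 * (k + 1) ^ 2 * ∫ y : ℝ, (1 + y ^ 2)⁻¹) * σ⁻¹ ^ k) := by gcongr
    _ = _ := by ring

lemma tendsto_fejerMean (hg : DerivSeq g M) (x : ℝ) :
    Tendsto (fun n : ℕ => fejerMean g (1 / ((n : ℝ) + 1)) 0 x) atTop (nhds (g 0 x)) := by
  have h : Tendsto (fun n : ℕ => ∫ y, g 0 (x + 1 / ((n : ℝ) + 1) * y) * fejer 0 y) atTop
      (nhds (∫ y, g 0 x * fejer 0 y)) := by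
    refine tendsto_integral_of_dominated_convergence (fun y => M 0 * |fejer 0 y|)
      (fun n => (hg.integrable_mul_fejer _ x 0 0).aestronglyMeasurable)
      ((integrable_fejer 0).abs.const_mul _) (fun n => ae_of_all _ fun y => ?_)
      (ae_of_all _ fun y => ?_)
    · rw [Real.norm_eq_abs, abs_mul]
      gcongr
      exact hg.abs_le _ _
    · have h1 : Tendsto (fun n : ℕ => x + 1 / ((n : ℝ) + 1) * y) atTop (nhds x) := by
        have := ((tendsto_one_div_add_atTop_nhds_zero_nat (𝕜 := ℝ)).mul_const y).const_add x
        simpa using this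
      exact (((hg.continuous 0).tendsto x).comp h1).mul_const _
  have h2 := h.const_mul (∫ y, fejer 0 y)⁻¹
  rw [integral_const_mul] at h2
  have hc := integral_fejer_pos.ne'
  convert! h2 using 2
  field_simp

lemma tendsto_integral_fejerMean (hg : DerivSeq g M) {Ω : Type*} [MeasurableSpace Ω]
    {P : Measure Ω} [IsProbabilityMeasure P] {X : Ω → ℝ} (hX : AEMeasurable X P) :
    Tendsto (fun n : ℕ => ∫ w, fejerMean g (1 / ((n : ℝ) + 1)) 0 (X w) ∂P) atTop
      (nhds (∫ w, g 0 (X w) ∂P)) :=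
  tendsto_integral_of_dominated_convergence (fun _ => M 0)
    (fun _ => (((hg.fejerMean_derivSeq _).continuous 0).measurable.comp_aemeasurable
      hX).aestronglyMeasurable)
    (integrable_const _) (fun _ => ae_of_all _ fun _ => (hg.fejerMean_derivSeq _).abs_le 0 _)
    (ae_of_all _ fun _ => hg.tendsto_fejerMean _)

end DerivSeq

lemma DerivSeq.abs_integral_sub_le {g : ℕ → ℝ → ℝ} {M : ℕ → ℝ} (hg : DerivSeq g M)
    {Ω : Type*} [MeasurableSpace Ω] {P : Measure Ω} [IsProbabilityMeasure P] {X : Ω → ℝ}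
    (hX : AEMeasurable X P) (hint : ∀ k, Integrable (fun w => |X w| ^ k) P) {C : ℝ}
    (hε : ∀ k, 1 ≤ k → M k * |momentDiff P X k| ≤ C * (k - 1)!)
    (hε' : ∀ k, 1 ≤ k → M (k + 2) * |momentDiff P X k| ≤ C * (k - 1)!) {T : ℝ}
    (hT : ∀ N, M 1 * |momentDiff P X 1| + ∑ j ∈ Finset.range N,
      M (j + 2) / (j + 2)! * |(j + 1) * momentDiff P X j - momentDiff P X (j + 2)| ≤ T) :
    |(∫ w, g 0 (X w) ∂P) - ∫ z, g 0 z ∂(gaussianReal 0 1)| ≤ T := by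
  have h1 := hg.tendsto_integral_fejerMean hX
  have h2 := hg.tendsto_integral_fejerMean (P := gaussianReal 0 1) (X := fun z => z) aemeasurable_id
  refine le_of_tendsto' (h1.sub h2).abs fun n => ?_
  have hσ : (0 : ℝ) < 1 / ((n : ℝ) + 1) := by positivity
  exact (hg.fejerMean_derivSeq _).abs_integral_sub_le_of_geometric (inv_nonneg.2 hσ.le)
    (hg.abs_fejerMean_le hσ) hX hint hε hε' hT

lemma IsCbInfty.derivSeq {h : ℝ → ℝ} (hh : IsCbInfty h) :
    DerivSeq (fun k => iteratedDeriv k h) (fun k => supNorm (iteratedDeriv k h)) where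
  hasDerivAt k x := by
    rw [iteratedDeriv_succ]
    exact (hh.1.differentiable_iteratedDeriv k
      (by exact_mod_cast WithTop.coe_lt_coe.2 (ENat.natCast_lt_top k)) x).hasDerivAt
  abs_le k x := by
    obtain ⟨B, hB⟩ := hh.2 k
    exact le_ciSup (f := fun x => |iteratedDeriv k h x|) ⟨B, by rintro _ ⟨y, rfl⟩; exact hB y⟩ x

lemma boundTerm_succ (h : ℝ → ℝ) (ε : ℕ → ℝ) (j : ℕ) :
    boundTerm h ε (j + 1)
      = supNorm (iteratedDeriv (j + 2) h) / (j + 2)! * |(j + 1) * ε j - ε (j + 2)| := by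
  simp [boundTerm]

lemma boundTerm_succ_le {h : ℝ → ℝ} (hh : IsCbInfty h) {ε : ℕ → ℝ} (h0 : ε 0 = 0) {c δ : ℝ}
    (hc : 0 ≤ c)
    (h1 : ∀ k : ℕ, 1 ≤ k → supNorm (iteratedDeriv k h) * |ε k| ≤ c * (k : ℝ) ^ (-δ) * (k - 1)!)
    (h2 : ∀ k : ℕ, 1 ≤ k →
      supNorm (iteratedDeriv (k + 2) h) * |ε k| ≤ c * (k : ℝ) ^ (-δ) * (k - 1)!) (j : ℕ) :
    boundTerm h ε (j + 1) ≤ c * ((j : ℝ) ^ (-δ - 1) + ((j + 2 : ℕ) : ℝ) ^ (-δ - 1)) := by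
  have hM : 0 ≤ supNorm (iteratedDeriv (j + 2) h) := hh.derivSeq.nonneg (j + 2)
  have hp : ∀ k : ℕ, 1 ≤ k → (k : ℝ) ^ (-δ - 1) = (k : ℝ) ^ (-δ) / k := fun k hk =>
    Real.rpow_sub_one (by positivity) _
  have e2 : supNorm (iteratedDeriv (j + 2) h) / (j + 2)! * |ε (j + 2)|
      ≤ c * ((j + 2 : ℕ) : ℝ) ^ (-δ - 1) := by
    have := h1 (j + 2) (by omega)
    calc _ = supNorm (iteratedDeriv (j + 2) h) * |ε (j + 2)| / (j + 2)! := by ring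
      _ ≤ c * ((j + 2 : ℕ) : ℝ) ^ (-δ) * (j + 1)! / (j + 2)! :=
          div_le_div_of_nonneg_right this (Nat.cast_nonneg _)
      _ = _ := by
        rw [hp (j + 2) (by omega), show (j + 2)! = (j + 2) * (j + 1)! from Nat.factorial_succ _]
        push_cast
        field_simp
  have e1 : supNorm (iteratedDeriv (j + 2) h) / (j + 2)! * ((j + 1) * |ε j|)
      ≤ c * (j : ℝ) ^ (-δ - 1) := by
    rcases Nat.eq_zero_or_pos j with rfl | hj
    · rw [h0, abs_zero, mul_zero, mul_zero]
      exact mul_nonneg hc (Real.rpow_nonneg (Nat.cast_nonneg _) _)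
    · obtain ⟨m, rfl⟩ := Nat.exists_eq_add_of_le' hj
      have := h2 (m + 1) hj
      rw [Nat.add_sub_cancel] at this
      calc _ = supNorm (iteratedDeriv (m + 1 + 2) h) * |ε (m + 1)|
              * (((m + 1 : ℕ) : ℝ) + 1) / (m + 1 + 2)! := by ring
        _ ≤ c * ((m + 1 : ℕ) : ℝ) ^ (-δ) * m ! * (((m + 1 : ℕ) : ℝ) + 1) / (m + 1 + 2)! := by gcongr
        _ = c * (m + 1 : ℕ) ^ (-δ - 1) / (m + 3) := by
          rw [hp (m + 1) hj, show (m + 1 + 2)! = (m + 3) * ((m + 2) * ((m + 1) * m !)) by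
            rw [Nat.factorial_succ, Nat.factorial_succ, Nat.factorial_succ]]
          push_cast
          field_simp
          ring
        _ ≤ _ := div_le_self (by positivity) (by linarith [(Nat.cast_nonneg m : (0 : ℝ) ≤ m)])
  rw [boundTerm_succ, mul_add]
  refine le_trans ?_ (add_le_add e1 e2)
  rw [← mul_add]
  gcongr
  refine (abs_sub _ _).trans_eq ?_
  rw [abs_mul, abs_of_nonneg (by positivity : (0 : ℝ) ≤ (j : ℝ) + 1)]

theorem mainTheorem5 (h : ℝ → ℝ) (hh : IsCbInfty h) (δ C : ℝ) (hδ : 0 < δ) (hC : 0 < C) :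
    ∃ K : ℝ, ∀ (α : ℝ), 0 < α →
      ∀ (Ω : ℕ → Type*) [∀ n, MeasurableSpace (Ω n)] (P : ∀ n, Measure (Ω n))
        [∀ n, IsProbabilityMeasure (P n)] (X : ∀ n, Ω n → ℝ),
        (∀ n, 1 ≤ n → AEMeasurable (X n) (P n)) →
        (∀ n, 1 ≤ n → ∀ k : ℕ, Integrable (fun w => |X n w| ^ k) (P n)) →
        (∀ n, 1 ≤ n →
          (fun k : ℕ => ∫ w, |X n w| ^ k ∂(P n)) =o[atTop] (fun k : ℕ => (k ! : ℝ))) →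
        (∀ n, 1 ≤ n → ∀ k : ℕ, 1 ≤ k →
          supNorm (iteratedDeriv k h) * |momentDiff (P n) (X n) k|
              ≤ C / (n : ℝ) ^ α * (k : ℝ) ^ (-δ) * ((k - 1)! : ℝ) ∧
          supNorm (iteratedDeriv (k + 2) h) * |momentDiff (P n) (X n) k|
              ≤ C / (n : ℝ) ^ α * (k : ℝ) ^ (-δ) * ((k - 1)! : ℝ)) →
        ∀ n, 1 ≤ n →
          Summable (fun j : ℕ => boundTerm h (momentDiff (P n) (X n)) (j + 1)) ∧
          |(∫ w, h (X n w) ∂(P n)) - ∫ z, h z ∂(gaussianReal 0 1)|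
            ≤ supNorm (iteratedDeriv 1 h) * |momentDiff (P n) (X n) 1|
              + ∑' j : ℕ, boundTerm h (momentDiff (P n) (X n)) (j + 1) ∧
          supNorm (iteratedDeriv 1 h) * |momentDiff (P n) (X n) 1|
              + ∑' j : ℕ, boundTerm h (momentDiff (P n) (X n)) (j + 1)
            ≤ K / (n : ℝ) ^ α := by
  have hs : Summable (fun j : ℕ => (j : ℝ) ^ (-δ - 1) + ((j + 2 : ℕ) : ℝ) ^ (-δ - 1)) := by
    have h1 : Summable (fun j : ℕ => (j : ℝ) ^ (-δ - 1)) :=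
      Real.summable_nat_rpow.2 (by linarith)
    exact h1.add ((summable_nat_add_iff 2).2 h1)
  refine ⟨C + C * ∑' j : ℕ, ((j : ℝ) ^ (-δ - 1) + ((j + 2 : ℕ) : ℝ) ^ (-δ - 1)), ?_⟩
  intro α _ Ω _ P _ X hX hint _ hbound n hn
  have hn0 : (0 : ℝ) < (n : ℝ) ^ α := Real.rpow_pos_of_pos (by exact_mod_cast hn) α
  set c := C / (n : ℝ) ^ α with hc
  have hc0 : 0 ≤ c := by positivity
  set ε := momentDiff (P n) (X n) with hεdef
  have h0 : ε 0 = 0 := momentDiff_zero _ _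
  have hb1 := fun k hk => (hbound n hn k hk).1
  have hb2 := fun k hk => (hbound n hn k hk).2
  have hle := boundTerm_succ_le hh h0 hc0 hb1 hb2
  have hnn : ∀ j, 0 ≤ boundTerm h ε (j + 1) := fun j => by
    have : 0 ≤ supNorm (iteratedDeriv (j + 2) h) := hh.derivSeq.nonneg (j + 2)
    rw [boundTerm_succ]
    positivity
  have hsum : Summable (fun j : ℕ => boundTerm h ε (j + 1)) :=
    Summable.of_nonneg_of_le hnn hle (hs.mul_left c)
  have hpow : ∀ k : ℕ, 1 ≤ k → c * (k : ℝ) ^ (-δ) * ((k - 1)! : ℝ) ≤ c * (k - 1)! := by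
    intro k hk
    have := Real.rpow_le_one_of_one_le_of_nonpos (x := (k : ℝ)) (z := -δ)
      (by exact_mod_cast hk) (by linarith)
    gcongr
    exact mul_le_of_le_one_right hc0 this
  refine ⟨hsum, ?_, ?_⟩
  · have := hh.derivSeq.abs_integral_sub_le (hX n hn) (hint n hn)
      (fun k hk => (hb1 k hk).trans (hpow k hk)) (fun k hk => (hb2 k hk).trans (hpow k hk))
      (T := supNorm (iteratedDeriv 1 h) * |ε 1| + ∑' j : ℕ, boundTerm h ε (j + 1)) fun N => by
        have := hsum.sum_le_tsum (Finset.range N) fun j _ => hnn j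
        simp only [boundTerm_succ] at this ⊢
        gcongr
    simpa using this
  · have e1 : supNorm (iteratedDeriv 1 h) * |ε 1| ≤ c := by
      simpa using hb1 1 le_rfl
    have e2 := hsum.tsum_le_tsum hle (hs.mul_left c)
    rw [tsum_mul_left] at e2
    calc _ ≤ c + c * ∑' j : ℕ, ((j : ℝ) ^ (-δ - 1) + ((j + 2 : ℕ) : ℝ) ^ (-δ - 1)) :=
          add_le_add e1 e2
      _ = _ := by rw [hc]; ring
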